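/- Let $\mathbb A=\langle A;\wedge,\vee,0,1,(\omega_{\mathbb A})_{\omega\in\Omega'}\rangle$ be a bounded lattice with additional operations, where each $\omega\in\Omega'$ has a finite arity $n_\omega\ge 0$ and $\omega_{\mathbb A}\colon A^{n_\omega}\to A$ is an arbitrary map. Call a map $f\colon A^n\to A$ an operator if it preserves binary joins in each coordinate, i.e. $f(a_1,\dots,a_i\vee b_i,\dots,a_n)=f(a_1,\dots,a_i,\dots,a_n)\vee f(a_1,\dots,b_i,\dots,a_n)$ for all $1\le i\le n$ and all elements of $A$. Let $e\colon A\to A^\sigma$ be a canonical extension of the lattice $A$, i.e. a lattice embedding into a complete lattice such that - (density) for all $u,v\in A^\sigma$ with $u\nleq v$ there are a filter $F$ and an ideal $I$ of $A$ with $\bigwedge e[F]\le u$, $\bigwedge e[F]\nleq v$, $v\le\bigvee e[I]$ and $u\nleq\bigvee e[I]$; - (compactness) for every ideal $I$ and every filter $F$ of $A$, if $\bigwedge e[F]\le\bigvee e[I]$, then there are $b\in F$ and $a\in I$ with $b\le a$ (filters and ideals are non-empty and may be all of $A$). Every lattice has a canonical extension, and it is unique up to isomorphism. Let $K(A^\sigma)=\{\bigwedge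 e[F]\mid F\text{ a filter of }A\}$ be the set of closed elements. For $f\colon A^n\to A$ put $$f^\sigma(x_1,\dots,x_n)=\bigwedge\{e(f(a_1,\dots,a_n))\mid a_i\in A,\ x_i\le e(a_i)\text{ for all }i\}\qquad(x_1,\dots,x_n\in K(A^\sigma)),$$ and then, for arbitrary $u_1,\dots,u_n\in A^\sigma$, $$f^\sigma(u_1,\dots,u_n)=\bigvee\{f^\sigma(x_1,\dots,x_n)\mid x_i\in K(A^\sigma),\ x_i\le u_i\text{ for all }i\}$$ (for order-preserving $f$, in particular for operators, the two formulas agree on closed elements). Let $\mathbb A^\sigma$ be the bounded lattice $A^\sigma$ with the additional operations $(\omega_{\mathbb A})^\sigma$, $\omega\in\Omega'$. Let $\Omega\subseteq\{\wedge,\vee,0,1\}\cup\Omega'$ consist entirely of operation symbols whose interpretations in $\mathbb A$ are operators, and let $s(x_1,\dots,x_n)$ and $t(x_1,\dots,x_n)$ be $n$-ary terms built from variables and symbols in $\Omega$. If $s\preccurlyeq t$ is valid in $\mathbb A$, i.e. $s^{\mathbb A}(a_1,\dots,a_n)\le t^{\mathbb A}(a_1,\dots,a_n)$ for all $a_1,\dots,a_n\in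 A$, then $s\preccurlyeq t$ is also valid in $\mathbb A^\sigma$. -/

import Mathlib

/-!
Bounded lattices with additional operations, operators, canonical extensions and
sigma-extensions of operations.

Filters and ideals are `Order.PFilter` and `Order.Ideal`: they are non-empty, and they may be the
whole lattice.
-/

namespace LatticeCanonicity

universe u v w

/-! ### Signatures, terms and inequalities -/

/-- The operation symbols of bounded lattices, indexed by their arities. -/
inductive LatticeSymbol : ℕ → Type
  | meet : LatticeSymbol 2
  | join : LatticeSymbol 2
  | zero : LatticeSymbol 0
  | one : LatticeSymbol 0

/-- The `n`-ary operation symbols of bounded lattices with additional operations,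
where `Ω' n` is the set of additional `n`-ary operation symbols. -/
abbrev OpSymbol (Ω' : ℕ → Type w) (n : ℕ) : Type w := LatticeSymbol n ⊕ Ω' n

/-- The interpretation of all operation symbols in a bounded lattice `B` with additional
operations `op`: the lattice symbols are interpreted by the lattice operations of `B`. -/
def interpret {B : Type u} [Lattice B] [BoundedOrder B] {Ω' : ℕ → Type w}
    (op : ∀ n, Ω' n → (Fin n → B) → B) : ∀ n, OpSymbol Ω' n → (Fin n → B) → B
  | _, Sum.inl .meet, x => x 0 ⊓ x 1
  | _, Sum.inl .join, x => x 0 ⊔ x 1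
  | _, Sum.inl .zero, _ => ⊥
  | _, Sum.inl .one, _ => ⊤
  | n, Sum.inr f, x => op n f x

/-- The purely algebraic language whose operation symbols are those in `Ω`. -/
def termLanguage {S : ℕ → Type w} (Ω : ∀ n, Set (S n)) : FirstOrder.Language.{w, 0} :=
  ⟨fun n => Ω n, fun _ => Empty⟩

/-- The set of `Ω`-terms in the variables `x_1, …, x_k`. -/
abbrev OmegaTerm {S : ℕ → Type w} (Ω : ∀ n, Set (S n)) (k : ℕ) : Type w :=
  (termLanguage Ω).Term (Fin k)

/-- The algebra for the language of `Ω` given by an interpretation of the operation symbols. -/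
@[reducible] def termStructure {S : ℕ → Type w} (Ω : ∀ n, Set (S n)) {B : Type u}
    (i : ∀ n, S n → (Fin n → B) → B) : (termLanguage Ω).Structure B where
  funMap := fun {n} (f : Ω n) x => i n f.1 x
  RelMap := fun {_} (r : Empty) _ => r.elim

/-- The bounded lattice `B` with additional operations `op` satisfies the inequality `s ≼ t`
between `Ω`-terms: the value of `s` is below that of `t` under every assignment. -/
def Satisfies {B : Type u} [Lattice B] [BoundedOrder B] {Ω' : ℕ → Type w}
    (op : ∀ n, Ω' n → (Fin n → B) → B) {Ω : ∀ n, Set (OpSymbol Ω' n)} {k : ℕ}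
    (s t : OmegaTerm Ω k) : Prop :=
  letI := termStructure Ω (interpret op)
  ∀ x : Fin k → B, s.realize x ≤ t.realize x

/-- An operator preserves binary joins in each coordinate. -/
def IsOperator {A : Type u} [Lattice A] {n : ℕ} (f : (Fin n → A) → A) : Prop :=
  ∀ (i : Fin n) (x : Fin n → A) (a b : A),
    f (Function.update x i (a ⊔ b)) = f (Function.update x i a) ⊔ f (Function.update x i b)

/-! ### Canonical extensions -/

/-- A lattice embedding `e` of `A` into a complete lattice `C` is a canonical extension of `A` if
it is dense and compact. -/
structure IsCanonicalExtension {A : Type u} [Lattice A] {C : Type v} [CompleteLattice C]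
    (e : LatticeHom A C) : Prop where
  injective : Function.Injective e
  dense : ∀ p q : C, ¬ p ≤ q → ∃ (F : Order.PFilter A) (I : Order.Ideal A),
    (⨅ a ∈ F, e a) ≤ p ∧ ¬ (⨅ a ∈ F, e a) ≤ q ∧
      q ≤ (⨆ a ∈ I, e a) ∧ ¬ p ≤ (⨆ a ∈ I, e a)
  compact : ∀ (I : Order.Ideal A) (F : Order.PFilter A),
    (⨅ a ∈ F, e a) ≤ (⨆ a ∈ I, e a) → ∃ b ∈ F, ∃ a ∈ I, b ≤ a

/-- The closed elements are the meets of the images of filters. -/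
def IsClosedElement {A : Type u} [Lattice A] {C : Type v} [CompleteLattice C]
    (e : LatticeHom A C) (x : C) : Prop :=
  ∃ F : Order.PFilter A, x = ⨅ a ∈ F, e a

/-- The sigma-extension of an operation at a tuple of closed elements. -/
def sigmaClosed {A : Type u} [Lattice A] {C : Type v} [CompleteLattice C]
    (e : LatticeHom A C) {n : ℕ} (f : (Fin n → A) → A) (x : Fin n → C) : C :=
  ⨅ (a : Fin n → A) (_ : ∀ i, x i ≤ e (a i)), e (f a)

/-- The sigma-extension of an operation. -/
def sigmaExt {A : Type u} [Lattice A] {C : Type v} [CompleteLattice C]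
    (e : LatticeHom A C) {n : ℕ} (f : (Fin n → A) → A) (p : Fin n → C) : C :=
  ⨆ (x : Fin n → C) (_ : (∀ i, IsClosedElement e (x i)) ∧ ∀ i, x i ≤ p i), sigmaClosed e f x

/-! ### Existence of canonical extensions -/

section Existence

variable (A : Type u) [Lattice A]

/-- A filter and an ideal are related if they meet. -/
def Meets (F : Order.PFilter A) (I : Order.Ideal A) : Prop := ∃ a, a ∈ F ∧ a ∈ I

/-- The embedding of a lattice into the lattice of Galois-closed sets of filters. -/
def conceptEmbedding : LatticeHom A (Concept (Order.PFilter A) (Order.Ideal A) (Meets A)) where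
  toFun a :=
    { extent := {F | a ∈ F}
      intent := {I | a ∈ I}
      upperPolar_extent := by
        ext I
        constructor
        · intro h
          obtain ⟨b, hb, hI⟩ := @h (Order.PFilter.principal a) (le_refl a)
          exact I.lower hb hI
        · intro hI F hF
          exact ⟨a, hF, hI⟩
      lowerPolar_intent := by
        ext F
        constructor
        · intro h
          obtain ⟨b, hF, hb⟩ := @h (Order.Ideal.principal a) (le_refl a)
          exact Order.PFilter.mem_of_le hb hF
        · intro hF I hI
          exact ⟨a, hF, hI⟩ }
  map_sup' a b := by
    apply Concept.ext'
    ext I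
    exact Order.Ideal.sup_mem_iff
  map_inf' a b := by
    apply Concept.ext
    ext F
    exact Order.PFilter.inf_mem_iff

/-- Every lattice has a canonical extension. -/
theorem exists_isCanonicalExtension :
    ∃ (C : Type u) (_ : CompleteLattice C) (e : LatticeHom A C), IsCanonicalExtension e := by
  refine ⟨_, inferInstance, conceptEmbedding A, ?_, ?_, ?_⟩
  · have key : ∀ a b : A, conceptEmbedding A a = conceptEmbedding A b → b ≤ a := by
      intro a b h
      have h1 : a ∈ Order.Ideal.principal a := le_refl a
      have h2 := congrArg Concept.intent h
      have h3 : Order.Ideal.principal a ∈ (conceptEmbedding A a).intent := h1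
      rw [h2] at h3
      exact h3
    intro a b h
    exact le_antisymm (key b a h.symm) (key a b h)
  · intro p q hpq
    obtain ⟨F, hFp, hFq⟩ := Set.not_subset.1 (fun h => hpq (Concept.extent_subset_extent_iff.1 h))
    rw [← q.lowerPolar_intent, mem_lowerPolar_iff] at hFq
    push Not at hFq
    obtain ⟨I, hIq, hFI⟩ := hFq
    have hF : F ∈ (⨅ a ∈ F, conceptEmbedding A a).extent := by
      simp only [Concept.extent_iInf, Set.mem_iInter]
      exact fun a ha => ha
    have hI : I ∈ (⨆ a ∈ I, conceptEmbedding A a).intent := by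
      simp only [Concept.intent_iSup, Set.mem_iInter]
      exact fun a ha => ha
    refine ⟨F, I, ?_, ?_, ?_, ?_⟩
    · rw [← Concept.extent_subset_extent_iff]
      intro G hG
      simp only [Concept.extent_iInf, Set.mem_iInter] at hG
      rw [← p.lowerPolar_intent]
      intro J hJ
      obtain ⟨a, haF, haJ⟩ := Concept.rel_extent_intent hFp hJ
      exact ⟨a, hG a haF, haJ⟩
    · intro h
      exact hFI (Concept.rel_extent_intent (Concept.extent_subset_extent_iff.2 h hF) hIq)
    · rw [← Concept.intent_subset_intent_iff]
      intro J hJ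
      simp only [Concept.intent_iSup, Set.mem_iInter] at hJ
      rw [← q.upperPolar_extent]
      intro G hG
      obtain ⟨a, haG, haI⟩ := Concept.rel_extent_intent hG hIq
      exact ⟨a, haG, hJ a haI⟩
    · intro h
      exact hFI (Concept.rel_extent_intent (Concept.extent_subset_extent_iff.2 h hFp) hI)
  · intro I F h
    have hF : F ∈ (⨅ a ∈ F, conceptEmbedding A a).extent := by
      simp only [Concept.extent_iInf, Set.mem_iInter]
      exact fun a ha => ha
    have hI : I ∈ (⨆ a ∈ I, conceptEmbedding A a).intent := by
      simp only [Concept.intent_iSup, Set.mem_iInter]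
      exact fun a ha => ha
    obtain ⟨a, haF, haI⟩ :=
      Concept.rel_extent_intent (Concept.extent_subset_extent_iff.2 h hF) hI
    exact ⟨a, haF, a, haI, le_refl a⟩

end Existence

end LatticeCanonicity

/-!
Write `t^A` and `t^C` for the term functions of an `Ω`-term `t` in the algebra and in its canonical
extension. The theorem follows from the identity `t^C = (t^A)^σ` (`eval_sigmaExt`), because `σ` is
monotone in the operation. The identity has two ingredients.

* On closed elements it holds for compositions of arbitrary monotone operations
  (`eval_sigmaExt_of_closed`). The elements above some `g a` with `x ≤ e a` form a filter, with meet
  `sigmaClosed e g x`, so compactness turns an inequality `sigmaClosed e g x ≤ ⨆ e[I]` into some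
  `a` with `x ≤ e a` and `g a ∈ I`, that is, into a statement about `A`.
* The value `t^C u` is the join of the values of `t^C` at closed tuples below `u`. This is where
  operators are needed: `f^σ` is determined by closed elements and preserves nonempty joins of
  closed elements in each coordinate (`sigmaClosed_update_le`, `sigmaExt_sSup_le`). Indeed, if
  `f^σ (…, d, …) ≤ ⨆ e[I]` for all `d ∈ D`, then the elements `a` for which `f (…, a, …) ∈ I`, with
  suitable other arguments from `A`, form an ideal `J`, because `f` preserves joins in that
  coordinate. By compactness `D` lies below `⨆ e[J]`, so a closed `z ≤ ⨆ D` is below `e a` for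
  some `a ∈ J`, whence `f^σ (…, z, …) ≤ ⨆ e[I]`. Density allows testing inequalities against
  the elements `⨆ e[I]` only.

Finally, the lattice operations of the canonical extension are the `σ`-extensions of those of `A`
(`interpret_sigmaExt`), so all symbols can be treated alike.
-/

namespace LatticeCanonicity

universe u v w

/-! ### Density and compactness -/

section Extension

variable {A : Type u} [Lattice A] {C : Type v} [CompleteLattice C] {e : LatticeHom A C}

theorem IsCanonicalExtension.le_of_forall_closed (he : IsCanonicalExtension e) {p q : C}
    (h : ∀ z, IsClosedElement e z → z ≤ p → z ≤ q) : p ≤ q := by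
  by_contra hpq
  obtain ⟨F, I, h1, h2, -, -⟩ := he.dense p q hpq
  exact h2 (h _ ⟨F, rfl⟩ h1)

theorem IsCanonicalExtension.le_of_forall_ideal (he : IsCanonicalExtension e) {p q : C}
    (h : ∀ I : Order.Ideal A, q ≤ (⨆ a ∈ I, e a) → p ≤ ⨆ a ∈ I, e a) : p ≤ q := by
  by_contra hpq
  obtain ⟨F, I, -, -, h3, h4⟩ := he.dense p q hpq
  exact h4 (h I h3)

/-- Compactness for a single closed element. -/
theorem IsCanonicalExtension.exists_mem_ideal (he : IsCanonicalExtension e) {z : C}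
    (hz : IsClosedElement e z) {I : Order.Ideal A} (h : z ≤ ⨆ a ∈ I, e a) :
    ∃ a ∈ I, z ≤ e a := by
  obtain ⟨F, rfl⟩ := hz
  obtain ⟨b, hb, a, ha, hba⟩ := he.compact I F h
  exact ⟨b, I.lower hba ha, iInf₂_le b hb⟩

theorem isClosedElement_map (e : LatticeHom A C) (a : A) : IsClosedElement e (e a) :=
  ⟨Order.PFilter.principal a, le_antisymm
    (le_iInf₂ fun _ hb => OrderHomClass.mono e (Order.PFilter.mem_principal.1 hb))
    (iInf₂_le a (Order.PFilter.mem_principal.2 le_rfl))⟩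

/-- Closed elements are closed under binary joins: the join is the meet of the intersection of the
filters. -/
theorem IsCanonicalExtension.isClosedElement_sup [OrderTop A] (he : IsCanonicalExtension e)
    {x y : C} (hx : IsClosedElement e x) (hy : IsClosedElement e y) :
    IsClosedElement e (x ⊔ y) := by
  have hF : Order.IsPFilter {a : A | x ≤ e a ∧ y ≤ e a} := by
    obtain ⟨F, rfl⟩ := hx
    obtain ⟨G, rfl⟩ := hy
    refine Order.IsPFilter.of_def
      ⟨⊤, iInf₂_le _ Order.PFilter.top_mem, iInf₂_le _ Order.PFilter.top_mem⟩ ?_ ?_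
    · intro a ha b hb
      refine ⟨a ⊓ b, ?_, inf_le_left, inf_le_right⟩
      rw [Set.mem_ofPred_eq, map_inf]
      exact ⟨le_inf ha.1 hb.1, le_inf ha.2 hb.2⟩
    · intro a b hab ha
      exact ⟨ha.1.trans (OrderHomClass.mono e hab), ha.2.trans (OrderHomClass.mono e hab)⟩
  refine ⟨hF.toPFilter, le_antisymm (le_iInf₂ fun a ha => sup_le ha.1 ha.2) ?_⟩
  refine he.le_of_forall_ideal fun I hI => ?_
  obtain ⟨a, ha, hxa⟩ := he.exists_mem_ideal hx (le_sup_left.trans hI)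
  obtain ⟨b, hb, hyb⟩ := he.exists_mem_ideal hy (le_sup_right.trans hI)
  refine (iInf₂_le (a ⊔ b) ?_).trans (le_iSup₂_of_le (a ⊔ b) (I.sup_mem ha hb) le_rfl)
  exact ⟨hxa.trans (OrderHomClass.mono e le_sup_left),
    hyb.trans (OrderHomClass.mono e le_sup_right)⟩

theorem IsCanonicalExtension.map_bot [OrderBot A] (he : IsCanonicalExtension e) : e ⊥ = ⊥ :=
  le_bot_iff.1 (he.le_of_forall_ideal fun I _ => le_iSup₂_of_le ⊥ I.bot_mem le_rfl)

theorem IsCanonicalExtension.map_top [OrderTop A] (he : IsCanonicalExtension e) : e ⊤ = ⊤ := by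
  refine top_le_iff.1 (he.le_of_forall_closed fun z hz _ => ?_)
  obtain ⟨F, rfl⟩ := hz
  exact iInf₂_le _ Order.PFilter.top_mem

theorem IsCanonicalExtension.isClosedElement_bot [OrderBot A] (he : IsCanonicalExtension e) :
    IsClosedElement e ⊥ :=
  he.map_bot ▸ isClosedElement_map e ⊥

theorem IsCanonicalExtension.isClosedElement_finset_sup [BoundedOrder A]
    (he : IsCanonicalExtension e) {ι : Type*} (s : Finset ι) (x : ι → C)
    (hx : ∀ i, IsClosedElement e (x i)) : IsClosedElement e (s.sup x) :=
  Finset.sup_induction he.isClosedElement_bot (fun _ ha _ hb => he.isClosedElement_sup ha hb)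
    fun i _ => hx i

/-! ### Sigma-extensions of monotone operations -/

theorem sigmaClosed_le {n : ℕ} {f : (Fin n → A) → A} {x : Fin n → C} {a : Fin n → A}
    (h : ∀ i, x i ≤ e (a i)) : sigmaClosed e f x ≤ e (f a) :=
  iInf₂_le a h

theorem sigmaClosed_mono {n : ℕ} (f : (Fin n → A) → A) : Monotone (sigmaClosed e f) :=
  fun _ _ hxy => le_iInf₂ fun _ ha => sigmaClosed_le fun i => (hxy i).trans (ha i)

theorem sigmaExt_mono {n : ℕ} (f : (Fin n → A) → A) : Monotone (sigmaExt e f) :=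
  fun _ _ hpq => iSup₂_le fun x hx => le_iSup₂_of_le x ⟨hx.1, fun i => (hx.2 i).trans (hpq i)⟩ le_rfl

theorem sigmaExt_mono_left {n : ℕ} {f g : (Fin n → A) → A} (h : ∀ a, f a ≤ g a)
    (p : Fin n → C) : sigmaExt e f p ≤ sigmaExt e g p :=
  iSup₂_mono fun _ _ => iInf₂_mono fun a _ => OrderHomClass.mono e (h a)

theorem sigmaExt_eq_sigmaClosed {n : ℕ} (f : (Fin n → A) → A) {x : Fin n → C}
    (hx : ∀ i, IsClosedElement e (x i)) : sigmaExt e f x = sigmaClosed e f x :=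
  le_antisymm (iSup₂_le fun _ hy => sigmaClosed_mono f hy.2)
    (le_iSup₂_of_le x ⟨hx, fun _ => le_rfl⟩ le_rfl)

/-- The value of `f^σ` at closed elements is the meet of the filter generated by the values of `f`
at the tuples above the given one. -/
theorem IsCanonicalExtension.exists_pfilter_sigmaClosed [OrderTop A]
    (he : IsCanonicalExtension e) {n : ℕ} {f : (Fin n → A) → A} (hf : Monotone f)
    (x : Fin n → C) :
    ∃ F : Order.PFilter A, (∀ c, c ∈ F ↔ ∃ a : Fin n → A, (∀ i, x i ≤ e (a i)) ∧ f a ≤ c) ∧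
      sigmaClosed e f x = ⨅ c ∈ F, e c := by
  have hF : Order.IsPFilter {c : A | ∃ a : Fin n → A, (∀ i, x i ≤ e (a i)) ∧ f a ≤ c} := by
    refine Order.IsPFilter.of_def ⟨f ⊤, ⊤, fun i => ?_, le_rfl⟩ ?_ ?_
    · rw [Pi.top_apply, he.map_top]
      exact le_top
    · rintro c ⟨a, ha, hac⟩ d ⟨b, hb, hbd⟩
      refine ⟨c ⊓ d, ⟨a ⊓ b, fun i => ?_, le_inf ((hf inf_le_left).trans hac)
        ((hf inf_le_right).trans hbd)⟩, inf_le_left, inf_le_right⟩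
      rw [Pi.inf_apply, map_inf]
      exact le_inf (ha i) (hb i)
    · rintro c d hcd ⟨a, ha, hac⟩
      exact ⟨a, ha, hac.trans hcd⟩
  refine ⟨hF.toPFilter, fun c => Iff.rfl,
    le_antisymm (le_iInf₂ ?_) (le_iInf₂ fun a ha => iInf₂_le (f a) ⟨a, ha, le_rfl⟩)⟩
  rintro c ⟨a, ha, hac⟩
  exact (sigmaClosed_le ha).trans (OrderHomClass.mono e hac)

theorem IsCanonicalExtension.isClosedElement_sigmaClosed [OrderTop A]
    (he : IsCanonicalExtension e) {n : ℕ} {f : (Fin n → A) → A} (hf : Monotone f)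
    (x : Fin n → C) : IsClosedElement e (sigmaClosed e f x) :=
  let ⟨F, _, h⟩ := he.exists_pfilter_sigmaClosed hf x
  ⟨F, h⟩

/-- Compactness for the values of sigma-extensions at closed elements. -/
theorem IsCanonicalExtension.exists_apply_mem_ideal [OrderTop A]
    (he : IsCanonicalExtension e) {n : ℕ} {f : (Fin n → A) → A} (hf : Monotone f)
    {x : Fin n → C} {I : Order.Ideal A} (h : sigmaClosed e f x ≤ ⨆ a ∈ I, e a) :
    ∃ a : Fin n → A, (∀ i, x i ≤ e (a i)) ∧ f a ∈ I := by
  obtain ⟨F, hF, hFx⟩ := he.exists_pfilter_sigmaClosed hf x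
  obtain ⟨b, hb, c, hc, hbc⟩ := he.compact I F (hFx ▸ h)
  obtain ⟨a, ha, hab⟩ := (hF b).1 hb
  exact ⟨a, ha, I.lower (hab.trans hbc) hc⟩

theorem IsCanonicalExtension.exists_apply_le [OrderTop A]
    (he : IsCanonicalExtension e) {n : ℕ} {f : (Fin n → A) → A} (hf : Monotone f)
    {x : Fin n → C} {b : A} (h : sigmaClosed e f x ≤ e b) :
    ∃ a : Fin n → A, (∀ i, x i ≤ e (a i)) ∧ f a ≤ b :=
  he.exists_apply_mem_ideal (I := Order.Ideal.principal b) hf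
    (h.trans (le_iSup₂_of_le b (Order.Ideal.mem_principal.2 le_rfl) le_rfl))

/-! ### Operators -/

theorem IsOperator.monotone {n : ℕ} {f : (Fin n → A) → A} (hf : IsOperator f) : Monotone f := by
  intro a b hab
  -- Raise the coordinates from `a i` to `b i` one at a time.
  suffices h : ∀ s : Finset (Fin n), f a ≤ f (s.piecewise b a) by
    simpa using h Finset.univ
  intro s
  induction s using Finset.induction_on with
  | empty => simp
  | insert i s hi ih =>
    rw [Finset.piecewise_insert]
    have h1 := hf i (s.piecewise b a) (a i) (b i)
    rw [sup_eq_right.2 (hab i)] at h1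
    have h2 : Function.update (s.piecewise b a) i (a i) = s.piecewise b a := by
      rw [Function.update_eq_self_iff, Finset.piecewise_eq_of_notMem _ _ _ hi]
    rw [h2] at h1
    exact ih.trans (h1 ▸ le_sup_left)

/-- The sigma-extension of an operator preserves nonempty joins in each coordinate, tested against
an ideal: the elements `a` for which some `f (…, a, …)` lies in `I` form an ideal `J` with
`D ≤ ⨆ e[J]`. -/
theorem IsCanonicalExtension.sigmaClosed_update_le [OrderTop A]
    (he : IsCanonicalExtension e) {n : ℕ} {f : (Fin n → A) → A} (hf : IsOperator f)
    (i : Fin n) (x : Fin n → C) {D : Set C} (hD : D.Nonempty) {I : Order.Ideal A}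
    (h : ∀ d ∈ D, sigmaClosed e f (Function.update x i d) ≤ ⨆ a ∈ I, e a)
    {z : C} (hz : IsClosedElement e z) (hzD : z ≤ sSup D) :
    sigmaClosed e f (Function.update x i z) ≤ ⨆ a ∈ I, e a := by
  have key : ∀ d ∈ D, ∃ a : A, d ≤ e a ∧ ∃ b : Fin n → A, (∀ j, j ≠ i → x j ≤ e (b j)) ∧
      f (Function.update b i a) ∈ I := by
    intro d hd
    obtain ⟨a, ha, haI⟩ := he.exists_apply_mem_ideal hf.monotone (h d hd)
    refine ⟨a i, by simpa using ha i, a, fun j hj => ?_, by simpa using haI⟩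
    simpa [hj] using ha j
  have hJ : Order.IsIdeal {a : A | ∃ b : Fin n → A, (∀ j, j ≠ i → x j ≤ e (b j)) ∧
      f (Function.update b i a) ∈ I} := by
    refine ⟨?_, ?_, ?_⟩
    · rintro a c hca ⟨b, hb, hbI⟩
      exact ⟨b, hb, I.lower (hf.monotone (update_le_update_iff.2
        ⟨hca, fun _ _ => le_rfl⟩)) hbI⟩
    · obtain ⟨d, hd⟩ := hD
      obtain ⟨a, -, ha⟩ := key d hd
      exact ⟨a, ha⟩
    · rintro a ⟨b, hb, hbI⟩ c ⟨b', hb', hbI'⟩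
      refine ⟨a ⊔ c, ⟨b ⊓ b', fun j hj => ?_, ?_⟩, le_sup_left, le_sup_right⟩
      · rw [Pi.inf_apply, map_inf]
        exact le_inf (hb j hj) (hb' j hj)
      · rw [hf]
        exact I.sup_mem
          (I.lower (hf.monotone (update_le_update_iff.2
            ⟨le_rfl, fun _ _ => inf_le_left⟩)) hbI)
          (I.lower (hf.monotone (update_le_update_iff.2
            ⟨le_rfl, fun _ _ => inf_le_right⟩)) hbI')
  have hzJ : z ≤ ⨆ a ∈ hJ.toIdeal, e a := by
    refine hzD.trans (sSup_le fun d hd => ?_)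
    obtain ⟨a, hda, ha⟩ := key d hd
    exact hda.trans (le_iSup₂_of_le a ha le_rfl)
  obtain ⟨a, ⟨b, hb, hbI⟩, hza⟩ := he.exists_mem_ideal hz hzJ
  refine (sigmaClosed_le (a := Function.update b i a) fun j => ?_).trans
    (le_iSup₂_of_le _ hbI le_rfl)
  rcases eq_or_ne j i with rfl | hj
  · simpa using hza
  · simpa [hj] using hb j hj

/-- The sigma-extension of an operator at joins of nonempty families of closed elements is
approximated by its values at tuples from the families. -/
theorem IsCanonicalExtension.sigmaExt_sSup_le [OrderTop A]
    (he : IsCanonicalExtension e) {n : ℕ} {f : (Fin n → A) → A} (hf : IsOperator f)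
    {D : Fin n → Set C} (hD : ∀ i, (D i).Nonempty) {q : C}
    (h : ∀ d : Fin n → C, (∀ i, d i ∈ D i) → sigmaClosed e f d ≤ q) :
    sigmaExt e f (fun i => sSup (D i)) ≤ q := by
  refine he.le_of_forall_ideal fun I hI => iSup₂_le fun z hz => ?_
  -- Pass from members of `D i` to closed elements below `sSup (D i)` one coordinate at a time.
  suffices H : ∀ (s : Finset (Fin n)) (x : Fin n → C), (∀ i ∉ s, x i ∈ D i) →
      (∀ i ∈ s, IsClosedElement e (x i) ∧ x i ≤ sSup (D i)) →
      sigmaClosed e f x ≤ ⨆ a ∈ I, e a from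
    H Finset.univ z (fun i hi => absurd (Finset.mem_univ i) hi) fun i _ => ⟨hz.1 i, hz.2 i⟩
  intro s
  induction s using Finset.induction_on with
  | empty => exact fun x hx _ => (h x fun i => hx i (Finset.notMem_empty i)).trans hI
  | insert i s hi ih =>
    intro x hx hxs
    obtain ⟨hc, hle⟩ := hxs i (Finset.mem_insert_self i s)
    rw [← Function.update_eq_self i x]
    refine he.sigmaClosed_update_le hf i x (hD i) (fun d hd => ih _ ?_ ?_) hc hle
    · intro j hj
      rcases eq_or_ne j i with rfl | hji
      · simpa using hd
      · simpa [hji] using hx j (by simp [hji, hj])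
    · intro j hj
      have hji : j ≠ i := fun hji => hi (hji ▸ hj)
      simpa [hji] using hxs j (Finset.mem_insert_of_mem hj)

/-! ### The lattice operations of the canonical extension -/

theorem IsCanonicalExtension.sigmaExt_inf (he : IsCanonicalExtension e) (p : Fin 2 → C) :
    sigmaExt e (fun a => a 0 ⊓ a 1) p = p 0 ⊓ p 1 := by
  refine le_antisymm (iSup₂_le fun x ⟨hx, hxp⟩ => ?_) (he.le_of_forall_closed fun z hz hzp => ?_)
  · refine (le_inf ?_ ?_).trans (inf_le_inf (hxp 0) (hxp 1))
    all_goals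
      obtain ⟨F, hF⟩ := hx 0
      obtain ⟨G, hG⟩ := hx 1
      obtain ⟨a₀, ha₀⟩ := F.nonempty
      obtain ⟨b₀, hb₀⟩ := G.nonempty
      have hxa : ∀ a ∈ F, ∀ b ∈ G, sigmaClosed e (fun a => a 0 ⊓ a 1) x ≤ e a ⊓ e b := by
        intro a ha b hb
        rw [← map_inf]
        refine sigmaClosed_le (f := fun a : Fin 2 → A => a 0 ⊓ a 1) (a := ![a, b])
          (Fin.forall_fin_two.2 ⟨?_, ?_⟩)
        · exact hF ▸ iInf₂_le a ha
        · exact hG ▸ iInf₂_le b hb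
    · rw [hF]
      exact le_iInf₂ fun a ha => (hxa a ha b₀ hb₀).trans inf_le_left
    · rw [hG]
      exact le_iInf₂ fun b hb => (hxa a₀ ha₀ b hb).trans inf_le_right
  · refine le_iSup₂_of_le (fun _ => z) ⟨fun _ => hz, Fin.forall_fin_two.2
      ⟨hzp.trans inf_le_left, hzp.trans inf_le_right⟩⟩ (le_iInf₂ fun a ha => ?_)
    rw [map_inf]
    exact le_inf (ha 0) (ha 1)

theorem IsCanonicalExtension.sigmaExt_sup [OrderBot A] (he : IsCanonicalExtension e)
    (p : Fin 2 → C) : sigmaExt e (fun a => a 0 ⊔ a 1) p = p 0 ⊔ p 1 := by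
  have hle : ∀ x : Fin 2 → C, x 0 ⊔ x 1 ≤ sigmaClosed e (fun a => a 0 ⊔ a 1) x := by
    refine fun x => le_iInf₂ fun a ha => ?_
    rw [map_sup]
    exact sup_le_sup (ha 0) (ha 1)
  refine le_antisymm (iSup₂_le fun x ⟨hx, hxp⟩ => ?_) (sup_le ?_ ?_)
  · refine le_trans (he.le_of_forall_ideal fun I hI => ?_) (sup_le_sup (hxp 0) (hxp 1))
    obtain ⟨a, ha, hxa⟩ := he.exists_mem_ideal (hx 0) (le_sup_left.trans hI)
    obtain ⟨b, hb, hxb⟩ := he.exists_mem_ideal (hx 1) (le_sup_right.trans hI)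
    exact (sigmaClosed_le (a := ![a, b]) (Fin.forall_fin_two.2 ⟨hxa, hxb⟩)).trans
      (le_iSup₂_of_le (a ⊔ b) (I.sup_mem ha hb) le_rfl)
  · refine he.le_of_forall_closed fun z hz hzp => le_iSup₂_of_le ![z, ⊥]
      ⟨Fin.forall_fin_two.2 ⟨hz, he.isClosedElement_bot⟩, Fin.forall_fin_two.2 ⟨hzp, bot_le⟩⟩ ?_
    exact le_trans (le_sup_left (a := z) (b := ⊥)) (hle ![z, ⊥])
  · refine he.le_of_forall_closed fun z hz hzp => le_iSup₂_of_le ![⊥, z]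
      ⟨Fin.forall_fin_two.2 ⟨he.isClosedElement_bot, hz⟩, Fin.forall_fin_two.2 ⟨bot_le, hzp⟩⟩ ?_
    exact le_trans (le_sup_right (a := ⊥) (b := z)) (hle ![⊥, z])

theorem sigmaExt_nullary (f : (Fin 0 → A) → A) (p : Fin 0 → C) :
    sigmaExt e f p = e (f Fin.elim0) := by
  rw [sigmaExt_eq_sigmaClosed f fun i => i.elim0]
  refine le_antisymm (sigmaClosed_le fun i => i.elim0) (le_iInf₂ fun a _ => ?_)
  rw [Subsingleton.elim a Fin.elim0]

/-- The basic operations of the canonical extension, those of the lattice included, are the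
sigma-extensions of the basic operations of the algebra. -/
theorem IsCanonicalExtension.interpret_sigmaExt [BoundedOrder A]
    (he : IsCanonicalExtension e) {Ω' : ℕ → Type w} (op : ∀ n, Ω' n → (Fin n → A) → A) :
    interpret (fun n ω => sigmaExt e (op n ω)) = fun n ω => sigmaExt e (interpret op n ω) := by
  funext n ω p
  rcases ω with (_ | _ | _ | _) | ω
  · exact (he.sigmaExt_inf p).symm
  · exact (he.sigmaExt_sup p).symm
  · exact he.map_bot.symm.trans (sigmaExt_nullary (e := e) (fun _ => ⊥) p).symm
  · exact he.map_top.symm.trans (sigmaExt_nullary (e := e) (fun _ => ⊤) p).symm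
  · rfl

end Extension

/-! ### Term functions -/

section Terms

variable {S : ℕ → Type w} {Ω : ∀ n, Set (S n)} {k : ℕ}

/-- The term function of an `Ω`-term under an interpretation `i` of the operation symbols. -/
def eval {B : Type u} (i : ∀ n, S n → (Fin n → B) → B) (t : OmegaTerm Ω k) (x : Fin k → B) : B :=
  letI := termStructure Ω i
  t.realize x

theorem eval_func {B : Type u} (i : ∀ n, S n → (Fin n → B) → B) {n : ℕ}
    (ω : (termLanguage Ω).Functions n) (ts : Fin n → OmegaTerm Ω k) (x : Fin k → B) :
    eval i (.func ω ts) x =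
      i n (Subtype.val (p := fun f => f ∈ Ω n) ω) fun j => eval i (ts j) x :=
  rfl

theorem eval_mono {B : Type u} [Preorder B] {i : ∀ n, S n → (Fin n → B) → B}
    (hi : ∀ n, ∀ ω ∈ Ω n, Monotone (i n ω)) (t : OmegaTerm Ω k) : Monotone (eval i t) := by
  intro x y hxy
  induction t with
  | var j => exact hxy j
  | func ω ts ih => exact hi _ _ ω.2 ih

variable {A : Type u} [Lattice A] [BoundedOrder A] {C : Type v} [CompleteLattice C]
  {e : LatticeHom A C}

/-- On closed elements, sigma-extensions of monotone operations commute with composition. -/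
theorem IsCanonicalExtension.eval_sigmaExt_of_closed (he : IsCanonicalExtension e)
    {i : ∀ n, S n → (Fin n → A) → A} (hi : ∀ n, ∀ ω ∈ Ω n, Monotone (i n ω))
    (t : OmegaTerm Ω k) {x : Fin k → C} (hx : ∀ j, IsClosedElement e (x j)) :
    eval (fun n ω => sigmaExt e (i n ω)) t x = sigmaClosed e (eval i t) x := by
  induction t with
  | var j =>
    refine le_antisymm (le_iInf₂ fun a ha => ha j) ?_
    obtain ⟨F, hF⟩ := hx j
    have hj : x j = eval (fun n ω => sigmaExt e (i n ω)) (.var j : OmegaTerm Ω k) x := rfl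
    rw [← hj, hF]
    refine le_iInf₂ fun a ha => ?_
    refine (sigmaClosed_le (a := Function.update ⊤ j a) fun l => ?_).trans
      (OrderHomClass.mono e ?_)
    · rcases eq_or_ne l j with rfl | hl
      · rw [Function.update_self, hF]
        exact iInf₂_le a ha
      · rw [Function.update_of_ne hl, Pi.top_apply, he.map_top]
        exact le_top
    · exact (Function.update_self j a (⊤ : Fin k → A)).le
  | @func n ω ts ih =>
    rw [eval_func, funext ih, sigmaExt_eq_sigmaClosed _ fun j =>
      he.isClosedElement_sigmaClosed (eval_mono hi (ts j)) x]
    refine le_antisymm (le_iInf₂ fun a ha => ?_) (le_iInf₂ fun b hb => ?_)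
    · rw [eval_func]
      exact sigmaClosed_le fun j => sigmaClosed_le ha
    · -- Compactness yields separate tuples for the subterms; their meet serves for all of them.
      choose a ha hab using fun j => he.exists_apply_le (eval_mono hi (ts j)) (hb j)
      refine (sigmaClosed_le (a := fun l => Finset.univ.inf fun j => a j l) fun l => ?_).trans
        (OrderHomClass.mono e ?_)
      · have hinf : ∀ s : Finset (Fin n), x l ≤ e (s.inf fun j => a j l) := by
          intro s
          refine Finset.inf_induction (p := fun c => x l ≤ e c) ?_ ?_ fun j _ => ha j l
          · rw [he.map_top]
            exact le_top
          · intro c hc d hd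
            rw [map_inf]
            exact le_inf hc hd
        exact hinf Finset.univ
      · rw [eval_func]
        refine hi n _ ω.2 fun j => (eval_mono hi (ts j) fun l => ?_).trans (hab j)
        exact Finset.inf_le (Finset.mem_univ j)

/-- For operators, sigma-extensions commute with composition. -/
theorem IsCanonicalExtension.eval_sigmaExt (he : IsCanonicalExtension e)
    {i : ∀ n, S n → (Fin n → A) → A} (hi : ∀ n, ∀ ω ∈ Ω n, IsOperator (i n ω))
    (t : OmegaTerm Ω k) (p : Fin k → C) :
    eval (fun n ω => sigmaExt e (i n ω)) t p = sigmaExt e (eval i t) p := by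
  have hmono : ∀ n, ∀ ω ∈ Ω n, Monotone (i n ω) := fun n ω hω => (hi n ω hω).monotone
  have hcl := fun (t : OmegaTerm Ω k) (x : Fin k → C) (hx : ∀ j, IsClosedElement e (x j)) =>
    he.eval_sigmaExt_of_closed hmono t hx
  refine le_antisymm ?_ (iSup₂_le fun x hx => ?_)
  · induction t with
    | var j =>
      refine he.le_of_forall_closed fun z hz hzp => ?_
      have hzc : ∀ l, IsClosedElement e (Function.update (⊥ : Fin k → C) j z l) := by
        intro l
        rcases eq_or_ne l j with rfl | hl
        · rwa [Function.update_self]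
        · rw [Function.update_of_ne hl]
          exact he.isClosedElement_bot
      refine le_iSup₂_of_le (Function.update ⊥ j z)
        ⟨hzc, update_le_iff.2 ⟨hzp, fun _ _ => bot_le⟩⟩ ?_
      rw [← hcl _ _ hzc]
      exact (Function.update_self j z (⊥ : Fin k → C)).ge
    | @func n ω ts ih =>
      rw [eval_func]
      let D : Fin n → Set C := fun j =>
        {d | ∃ x : Fin k → C, (∀ l, IsClosedElement e (x l)) ∧ (∀ l, x l ≤ p l) ∧
          d = sigmaClosed e (eval i (ts j)) x}
      refine le_trans (sigmaExt_mono _ fun j => (ih j).trans ?_)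
        (he.sigmaExt_sSup_le (hi n _ ω.2) (D := D) (fun j => ?_) fun d hd => ?_)
      · exact iSup₂_le fun x hx => le_sSup ⟨x, hx.1, hx.2, rfl⟩
      · exact ⟨_, fun _ => ⊥, fun _ => he.isClosedElement_bot, fun _ => bot_le, rfl⟩
      · -- The closed tuples below `p` are directed, so one of them serves for all subterms.
        choose x hx hxp hdx using hd
        have hsup : ∀ l, IsClosedElement e (Finset.univ.sup fun j => x j l) := fun l =>
          he.isClosedElement_finset_sup _ _ fun j => hx j l
        refine le_iSup₂_of_le (fun l => Finset.univ.sup fun j => x j l)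
          ⟨hsup, fun l => Finset.sup_le fun j _ => hxp j l⟩ ?_
        rw [← hcl _ _ hsup, eval_func]
        refine le_trans (sigmaClosed_mono _ fun j => ?_)
          (sigmaExt_eq_sigmaClosed _ fun j => ?_).ge
        · rw [hdx j, hcl _ _ hsup]
          exact sigmaClosed_mono _ fun l => Finset.le_sup (f := fun j => x j l) (Finset.mem_univ j)
        · rw [hcl _ _ hsup]
          exact he.isClosedElement_sigmaClosed (eval_mono hmono (ts j)) _
  · rw [← hcl _ _ hx.1]
    exact eval_mono (fun n ω _ => sigmaExt_mono _) t hx.2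

end Terms

end LatticeCanonicity

/-- Inequalities between terms built from operators are inherited by the canonical extension. -/
theorem theorem3p8 {A : Type*} [Lattice A] [BoundedOrder A]
    {Ω' : ℕ → Type*} (op : ∀ n, Ω' n → (Fin n → A) → A)
    (Ω : ∀ n, Set (LatticeCanonicity.OpSymbol Ω' n))
    (hΩ : ∀ n, ∀ ω ∈ Ω n, LatticeCanonicity.IsOperator (LatticeCanonicity.interpret op n ω))
    {C : Type*} [CompleteLattice C] (e : LatticeHom A C)
    (he : LatticeCanonicity.IsCanonicalExtension e)
    {k : ℕ} (s t : LatticeCanonicity.OmegaTerm Ω k)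
    (hst : LatticeCanonicity.Satisfies op s t) :
    LatticeCanonicity.Satisfies (fun n ω => LatticeCanonicity.sigmaExt e (op n ω)) s t := by
  intro p
  change LatticeCanonicity.eval _ s p ≤ LatticeCanonicity.eval _ t p
  rw [he.interpret_sigmaExt op, he.eval_sigmaExt hΩ, he.eval_sigmaExt hΩ]
  exact LatticeCanonicity.sigmaExt_mono_left hst p
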